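/- All groups are abelian, $\mathrm{Ext}$ denotes $\mathrm{Ext}^1_{\mathbb Z}$, and a group $A$ is called a \emph{Whitehead group} if $\mathrm{Ext}(A,\mathbb Z)=0$. Assume GCH, i.e. $2^{\kappa}=\kappa^{+}$ for every infinite cardinal $\kappa$. Suppose that for every Whitehead group $A$ of infinite rank there is a Whitehead group $H_A$ of cardinality at most $|A|^{+}$ such that $\mathrm{Ext}(H_A,A)\neq 0$. Then for every Whitehead group $B$ there is an uncountable Whitehead group $G$ such that every homomorphism from $G$ to $B$ has finitely generated range. -/

import Mathlib

open Cardinal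

universe u

/-- The generalized continuum hypothesis: `2 ^ κ = κ⁺` for every infinite cardinal `κ`. -/
def GCH : Prop := ∀ κ : Cardinal.{u}, ℵ₀ ≤ κ → 2 ^ κ = Order.succ κ

/-- The group `Ext(A, C) = Ext¹_ℤ(A, C)` of two abelian groups. -/
abbrev ExtGroup (A C : Type u) [AddCommGroup A] [AddCommGroup C] : Type u :=
  CategoryTheory.Abelian.Ext.{u} (ModuleCat.of ℤ A) (ModuleCat.of ℤ C) 1

/-- An abelian group `A` is a Whitehead group if `Ext(A, ℤ) = 0`. The integers are lifted to the
universe of `A`. -/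
def IsWhitehead (A : Type u) [AddCommGroup A] : Prop :=
  Subsingleton (ExtGroup A (ULift.{u} ℤ))

open CategoryTheory Abelian Limits

universe w v₁ u₁ t

/-!
Let `B` be a Whitehead group. Its subgroups `A` are Whitehead groups, and those that are not
finitely generated have infinite rank (by Pontryagin duality and the Baire category theorem), so
there is a Whitehead group `H` with `Ext(H, A) ≠ 0`. Take a free presentation `0 → K → F → H → 0`
and a homomorphism `K → A` that does not extend to `F`. If `h : X → B` has range `A`, that
homomorphism lifts along `h` to `K → X`, and `h` does not extend to a homomorphism to `A` from the
pushout of `F ← K → X`. Treating all such `h` at once gives an embedding `X → Y` with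
`Ext(Y / X, ℤ) = 0`, such that a homomorphism from `Y` to `B` taking the same values on `X` as on
`Y` has finitely generated range. Iterate along a regular cardinal larger than `B`, starting from a
free group: by Eklof's lemma the colimit is a Whitehead group, and the range of a homomorphism from
it to `B` is already attained at some stage, hence finitely generated by the choice of the next.
-/

/-! ### Vanishing of `Ext¹` as a lifting property -/

section Ext

variable {C : Type u₁} [Category.{v₁} C] [Abelian C] [HasExt.{w} C]

lemma subsingleton_ext_one_iff_forall_exists_lift {S : ShortComplex C} (hS : S.ShortExact)
    [Injective S.X₂] (X : C) :
    Subsingleton (Ext.{w} X S.X₁ 1) ↔ ∀ f : X ⟶ S.X₃, ∃ g : X ⟶ S.X₂, g ≫ S.g = f := by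
  constructor
  · intro h f
    obtain ⟨x, hx⟩ := Ext.covariant_sequence_exact₃ X hS (Ext.mk₀ f) (zero_add 1)
      (Subsingleton.elim _ _)
    obtain ⟨g, rfl⟩ := (Ext.mk₀_bijective _ _).2 x
    rw [Ext.mk₀_comp_mk₀] at hx
    exact ⟨g, (Ext.mk₀_bijective _ _).1 hx⟩
  · refine fun h => subsingleton_of_forall_eq 0 fun x => ?_
    obtain ⟨y, rfl⟩ := Ext.covariant_sequence_exact₁ X hS x (Ext.eq_zero_of_injective _)
      (zero_add 1)
    obtain ⟨f, rfl⟩ := (Ext.mk₀_bijective _ _).2 y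
    obtain ⟨g, rfl⟩ := h f
    rw [← Ext.mk₀_comp_mk₀, Ext.comp_assoc_of_second_deg_zero, hS.comp_extClass, Ext.comp_zero]

lemma subsingleton_ext_one_of_forall_exists_extension {S : ShortComplex C} (hS : S.ShortExact)
    [Projective S.X₂] {Y : C} (h : ∀ k : S.X₁ ⟶ Y, ∃ g : S.X₂ ⟶ Y, S.f ≫ g = k) :
    Subsingleton (Ext.{w} S.X₃ Y 1) := by
  refine subsingleton_of_forall_eq 0 fun x => ?_
  obtain ⟨y, rfl⟩ := Ext.contravariant_sequence_exact₃ hS Y x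
    (Ext.eq_zero_of_projective _) (add_zero 1)
  obtain ⟨f, rfl⟩ := (Ext.mk₀_bijective _ _).2 y
  obtain ⟨g, rfl⟩ := h f
  rw [← Ext.mk₀_comp_mk₀, hS.extClass_comp_assoc]

lemma subsingleton_ext_X₂ {S : ShortComplex C} (hS : S.ShortExact) {N : C} {n : ℕ}
    (h₁ : Subsingleton (Ext.{w} S.X₁ N n)) (h₃ : Subsingleton (Ext.{w} S.X₃ N n)) :
    Subsingleton (Ext.{w} S.X₂ N n) := by
  refine subsingleton_of_forall_eq 0 fun x => ?_
  obtain ⟨y, rfl⟩ := Ext.contravariant_sequence_exact₂ hS N x (Subsingleton.elim _ _)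
  rw [Subsingleton.elim y 0, Ext.comp_zero]

lemma subsingleton_ext_one_of_mono {X Y : C} (i : X ⟶ Y) [Mono i]
    [HasProjectiveDimensionLT (cokernel i) 2] {N : C} (hY : Subsingleton (Ext.{w} Y N 1)) :
    Subsingleton (Ext.{w} X N 1) := by
  have hS : (ShortComplex.mk i _ (cokernel.condition i)).ShortExact :=
    { exact := ShortComplex.exact_cokernel i }
  refine subsingleton_of_forall_eq 0 fun x => ?_
  obtain ⟨y, rfl⟩ := Ext.contravariant_sequence_exact₁ hS N x (n₁ := 2) rfl
    (Ext.eq_zero_of_hasProjectiveDimensionLT _ 2 le_rfl)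
  rw [Subsingleton.elim y 0, Ext.comp_zero]

lemma hasLiftingProperty_iff_subsingleton_ext_one {T S : ShortComplex C} (hT : T.ShortExact)
    (hS : S.ShortExact) [Injective S.X₂] :
    HasLiftingProperty T.f S.g ↔ Subsingleton (Ext.{w} T.X₃ S.X₁ 1) := by
  have := hT.mono_f
  have := hT.epi_g
  rw [subsingleton_ext_one_iff_forall_exists_lift hS]
  constructor
  · intro h f
    have sq : CommSq (0 : T.X₁ ⟶ S.X₂) T.f S.g (T.g ≫ f) := ⟨by simp⟩
    refine ⟨hT.exact.desc sq.lift sq.fac_left, ?_⟩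
    rw [← cancel_epi T.g, hT.exact.g_desc_assoc, sq.fac_right]
  · refine fun h => ⟨fun {a b} sq => ?_⟩
    let a' : T.X₂ ⟶ S.X₂ := Injective.factorThru a T.f
    have ha' : T.f ≫ a' = a := Injective.comp_factorThru _ _
    have hdiff : T.f ≫ (b - a' ≫ S.g) = 0 := by
      rw [Preadditive.comp_sub, reassoc_of% ha', sq.w, sub_self]
    obtain ⟨g, hg⟩ := h (hT.exact.desc _ hdiff)
    exact ⟨⟨a' + T.g ≫ g, by simp [ha'], by simp [hg]⟩⟩

/-- The monomorphisms `i` such that `Ext¹(coker i, N) = 0`. Along a transfinite composition of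
such maps the vanishing of `Ext¹(-, N)` is preserved (Eklof's lemma). -/
def extOrthogonalMonos (N : C) : MorphismProperty C :=
  fun _ _ i => Mono i ∧ Subsingleton (Ext.{w} (cokernel i) N 1)

namespace extOrthogonalMonos

lemma subsingleton_ext {N X Y : C} {i : X ⟶ Y} (hi : extOrthogonalMonos.{w} N i)
    (hX : Subsingleton (Ext.{w} X N 1)) : Subsingleton (Ext.{w} Y N 1) :=
  have := hi.1
  subsingleton_ext_X₂ { exact := ShortComplex.exact_cokernel i } hX hi.2

lemma eq_inf_llp {S : ShortComplex C} (hS : S.ShortExact) [Injective S.X₂] :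
    extOrthogonalMonos.{w} S.X₁ =
      MorphismProperty.monomorphisms C ⊓ (MorphismProperty.ofHoms fun _ : Unit => S.g).llp := by
  ext X Y i
  refine and_congr_right fun (_ : Mono i) => ?_
  rw [MorphismProperty.llp_ofHoms_iff_hasLiftingProperty]
  exact (hasLiftingProperty_iff_subsingleton_ext_one
    (T := ShortComplex.mk i _ (cokernel.condition i))
    { exact := ShortComplex.exact_cokernel i } hS).symm

lemma exists_eq_inf_llp [EnoughInjectives C] (N : C) :
    ∃ W : MorphismProperty C,
      extOrthogonalMonos.{w} N = MorphismProperty.monomorphisms C ⊓ W.llp := by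
  obtain ⟨P⟩ := EnoughInjectives.presentation N
  exact ⟨_, eq_inf_llp (S := P.shortComplex) P.shortExact_shortComplex⟩

lemma f_iff [EnoughInjectives C] {N : C} {T : ShortComplex C} (hT : T.ShortExact) :
    extOrthogonalMonos.{w} N T.f ↔ Subsingleton (Ext.{w} T.X₃ N 1) := by
  have := hT.mono_f
  obtain ⟨P⟩ := EnoughInjectives.presentation N
  rw [← hasLiftingProperty_iff_subsingleton_ext_one hT P.shortExact_shortComplex,
    eq_inf_llp (S := P.shortComplex) P.shortExact_shortComplex]
  exact (and_iff_right this).trans (MorphismProperty.llp_ofHoms_iff_hasLiftingProperty _ _ _)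

end extOrthogonalMonos

end Ext

section MorphismProperty

variable {C : Type u₁} [Category.{v₁} C]

instance (W W' : MorphismProperty C) (J : Type*) [Category J]
    [W.IsStableUnderColimitsOfShape J] [W'.IsStableUnderColimitsOfShape J] :
    (W ⊓ W').IsStableUnderColimitsOfShape J where
  condition X₁ X₂ c₁ c₂ h₁ h₂ f hf φ hφ :=
    ⟨MorphismProperty.IsStableUnderColimitsOfShape.condition X₁ X₂ c₁ c₂ h₁ h₂ f
      (fun j => (hf j).1) φ hφ,
    MorphismProperty.IsStableUnderColimitsOfShape.condition X₁ X₂ c₁ c₂ h₁ h₂ f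
      (fun j => (hf j).2) φ hφ⟩

instance (W W' : MorphismProperty C) (J : Type*) [LinearOrder J] [SuccOrder J] [OrderBot J]
    [WellFoundedLT J] [W.IsStableUnderTransfiniteCompositionOfShape J]
    [W'.IsStableUnderTransfiniteCompositionOfShape J] :
    (W ⊓ W').IsStableUnderTransfiniteCompositionOfShape J where
  le := le_inf
    ((MorphismProperty.transfiniteCompositionsOfShape_monotone J inf_le_left).trans
      (W.transfiniteCompositionsOfShape_le J))
    ((MorphismProperty.transfiniteCompositionsOfShape_monotone J inf_le_right).trans
      (W'.transfiniteCompositionsOfShape_le J))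

variable {W : MorphismProperty C}

lemma exists_forall_factors_of_isStableUnderCoproducts [HasCoproducts.{w} C] [HasPushouts C]
    [W.IsStableUnderCobaseChange] [MorphismProperty.IsStableUnderCoproducts.{w} W] {X : C}
    {ι : Type w} {Y : ι → C} (i : ∀ k, X ⟶ Y k) (hi : ∀ k, W (i k)) :
    ∃ (Z : C) (j : X ⟶ Z), W j ∧ ∀ k, ∃ q : Y k ⟶ Z, i k ≫ q = j := by
  let fold : (∐ fun _ : ι => X) ⟶ X := Sigma.desc fun _ => 𝟙 X
  refine ⟨pushout fold (Limits.Sigma.map i), pushout.inl _ _,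
    W.pushout_inl _ _ (MorphismProperty.colimMap _ fun k => hi k.as),
    fun k => ⟨Sigma.ι Y k ≫ pushout.inr _ _, ?_⟩⟩
  rw [← Sigma.ι_map_assoc, ← pushout.condition, Sigma.ι_desc_assoc, Category.id_comp]

end MorphismProperty

section Grothendieck

variable {C : Type u₁} [Category.{v₁} C] [Abelian C] [IsGrothendieckAbelian.{w} C]

namespace extOrthogonalMonos

variable (N : C)

instance : (extOrthogonalMonos.{w} N).IsStableUnderCobaseChange := by
  obtain ⟨W, hW⟩ := exists_eq_inf_llp.{w} N
  rw [hW]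
  infer_instance

instance : MorphismProperty.IsStableUnderCoproducts.{w} (extOrthogonalMonos.{w} N) where
  isStableUnderCoproductsOfShape J := by
    obtain ⟨W, hW⟩ := exists_eq_inf_llp.{w} N
    rw [hW]
    infer_instance

instance :
    MorphismProperty.IsStableUnderTransfiniteComposition.{w} (extOrthogonalMonos.{w} N) where
  isStableUnderTransfiniteCompositionOfShape J := by
    obtain ⟨W, hW⟩ := exists_eq_inf_llp.{w} N
    rw [hW]
    infer_instance

end extOrthogonalMonos

variable [EnoughProjectives C] {N : C}

lemma exists_extOrthogonalMonos_forall_comp_ne {X R H : C} (r : X ⟶ R) [Epi r]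
    [HasProjectiveDimensionLT H 2] [Subsingleton (Ext.{w} H N 1)] [Nontrivial (Ext.{w} H R 1)] :
    ∃ (Y : C) (i : X ⟶ Y), extOrthogonalMonos.{w} N i ∧ ∀ s : Y ⟶ R, i ≫ s ≠ r := by
  let S := ShortComplex.mk _ _ (kernel.condition (Projective.π H))
  have hS : S.ShortExact := { exact := ShortComplex.exact_kernel (Projective.π H) }
  have : Projective S.X₂ := inferInstanceAs (Projective (Projective.over H))
  have : Projective S.X₁ := projective_iff_hasProjectiveDimensionLT_one.2
    (hS.hasProjectiveDimensionLT_X₁ 1 inferInstance ‹HasProjectiveDimensionLT H 2›)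
  have : Nontrivial (Ext.{w} S.X₃ R 1) := ‹Nontrivial (Ext.{w} H R 1)›
  obtain ⟨k, hk⟩ : ∃ k : S.X₁ ⟶ R, ∀ g : S.X₂ ⟶ R, S.f ≫ g ≠ k := by
    by_contra! h
    exact not_subsingleton (Ext.{w} S.X₃ R 1)
      (subsingleton_ext_one_of_forall_exists_extension hS h)
  let l : S.X₁ ⟶ X := Projective.factorThru k r
  have hl : l ≫ r = k := Projective.factorThru_comp k r
  have hSf : extOrthogonalMonos.{w} N S.f := (extOrthogonalMonos.f_iff hS).2 ‹_›
  refine ⟨pushout l S.f, pushout.inl _ _, (extOrthogonalMonos.{w} N).pushout_inl l S.f hSf,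
    fun s hs => hk (pushout.inr l S.f ≫ s) ?_⟩
  rw [← pushout.condition_assoc, hs, hl]

lemma exists_extOrthogonalMonos_forall_forall_comp_ne {X : C} {ι : Type w} (R : ι → C)
    (r : ∀ k, X ⟶ R k) [∀ k, Epi (r k)]
    (h : ∀ k, ∃ H : C, HasProjectiveDimensionLT H 2 ∧ Subsingleton (Ext.{w} H N 1) ∧
      Nontrivial (Ext.{w} H (R k) 1)) :
    ∃ (Y : C) (i : X ⟶ Y), extOrthogonalMonos.{w} N i ∧ ∀ k (s : Y ⟶ R k), i ≫ s ≠ r k := by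
  have hsingle (k : ι) : ∃ (Y : C) (i : X ⟶ Y),
      extOrthogonalMonos.{w} N i ∧ ∀ s : Y ⟶ R k, i ≫ s ≠ r k := by
    obtain ⟨H, _, _, _⟩ := h k
    exact exists_extOrthogonalMonos_forall_comp_ne (H := H) (r k)
  choose Y i hi hr using hsingle
  obtain ⟨Z, j, hj, hfac⟩ := exists_forall_factors_of_isStableUnderCoproducts i hi
  refine ⟨Z, j, hj, fun k s hs => ?_⟩
  obtain ⟨q, rfl⟩ := hfac k
  exact hr k (q ≫ s) (by rw [← Category.assoc, hs])

end Grothendieck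

/-! ### Ranges of morphisms out of a transfinite iteration -/

section ConcreteCategory

variable {C : Type u₁} [Category.{v₁} C] {FC : C → C → Type*} {CC : C → Type t}
  [∀ X Y, FunLike (FC X Y) (CC X) (CC Y)] [ConcreteCategory C FC]

lemma exists_range_comp_ι_eq {J : Type w} [SmallCategory J] {κ : Cardinal.{w}}
    [Fact κ.IsRegular] [IsCardinalFiltered J κ] {F : J ⥤ C} [PreservesColimit F (forget C)]
    {c : Cocone F} (hc : IsColimit c) {α : Type*} (f : ToType c.pt → α)
    (hf : HasCardinalLT (Set.range f) κ) :
    ∃ j, Set.range (f ∘ c.ι.app j) = Set.range f := by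
  have hrep (b : Set.range f) : ∃ (j : J) (x : ToType (F.obj j)), f (c.ι.app j x) = b := by
    obtain ⟨_, y, rfl⟩ := b
    obtain ⟨j, x, rfl⟩ := Concrete.isColimit_exists_rep F hc y
    exact ⟨j, x, rfl⟩
  choose j x hx using hrep
  refine ⟨IsCardinalFiltered.max j hf,
    (Set.range_comp_subset_range _ _).antisymm fun b hb => ?_⟩
  refine ⟨F.map (IsCardinalFiltered.toMax j hf ⟨b, hb⟩) (x ⟨b, hb⟩), ?_⟩
  rw [Function.comp_apply, ← ConcreteCategory.comp_apply, c.w, hx]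

end ConcreteCategory

section TransfiniteIteration

variable {C : Type u₁} [Category.{v₁} C]

lemma exists_toSucc_comp_eq_iterationCocone_ι (Φ : SmallObject.SuccStruct C) {J : Type w}
    [LinearOrder J] [OrderBot J] [SuccOrder J] [WellFoundedLT J] [HasIterationOfShape J C]
    {j : J} (hj : ¬ IsMax j) :
    ∃ b : Φ.succ ((Φ.iterationFunctor J).obj j) ⟶ Φ.iteration J,
      Φ.toSucc _ ≫ b = (Φ.iterationCocone J).ι.app j := by
  refine ⟨(Φ.iterationFunctorObjSuccIso j hj).inv ≫
    (Φ.iterationCocone J).ι.app (Order.succ j), ?_⟩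
  rw [← (Φ.iterationCocone J).w (homOfLE (Order.le_succ j)), Φ.iterationFunctor_map_succ j hj,
    Category.assoc]
  rfl

variable {FC : C → C → Type*} {CC : C → Type t}
  [∀ X Y, FunLike (FC X Y) (CC X) (CC Y)] [ConcreteCategory C FC]

lemma exists_range_toSucc_comp_eq (Φ : SmallObject.SuccStruct C) {J : Type w} [LinearOrder J]
    [OrderBot J] [SuccOrder J] [NoMaxOrder J] [WellFoundedLT J] [HasIterationOfShape J C]
    {κ : Cardinal.{w}} [Fact κ.IsRegular] [IsCardinalFiltered J κ]
    [PreservesColimit (Φ.iterationFunctor J) (forget C)] {M : C} (f : Φ.iteration J ⟶ M)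
    (hf : HasCardinalLT (Set.range f) κ) :
    ∃ (X : C) (b : Φ.succ X ⟶ Φ.iteration J), Set.range (Φ.toSucc X ≫ b ≫ f) = Set.range f := by
  obtain ⟨j, hj⟩ := exists_range_comp_ι_eq (Φ.isColimitIterationCocone J) f hf
  obtain ⟨b, hb⟩ := exists_toSucc_comp_eq_iterationCocone_ι Φ (not_isMax j)
  refine ⟨_, b, .trans ?_ hj⟩
  rw [← Category.assoc, ConcreteCategory.coe_comp, hb]
  rfl

theorem exists_mem_forall_range_of_forall_range_comp_eq [HasColimitsOfSize.{w, w} C]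
    [PreservesFilteredColimitsOfSize.{w, w} (forget C)] {W : MorphismProperty C}
    [MorphismProperty.IsStableUnderTransfiniteComposition.{w} W] {M : C} [Small.{w} (ToType M)]
    {Q : Set (ToType M) → Prop}
    (hQ : ∀ X : C, ∃ (Y : C) (i : X ⟶ Y), W i ∧
      ∀ f : Y ⟶ M, Set.range (i ≫ f) = Set.range f → Q (Set.range f))
    (X : C) : ∃ (Y : C) (i : X ⟶ Y), W i ∧ ∀ f : Y ⟶ M, Q (Set.range f) := by
  choose Y i hi hQ using hQ
  let Φ : SmallObject.SuccStruct C := { X₀ := X, succ := Y, toSucc := i }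
  have hΦ : Φ.prop ≤ W := by
    rintro _ _ _ ⟨_⟩
    exact hi _
  obtain ⟨κ, hκ, hM⟩ := HasCardinalLT.exists_regular_cardinal.{w} (ToType M)
  have : Fact κ.IsRegular := ⟨hκ⟩
  let J := κ.ord.ToType
  have : Nonempty J := Ordinal.nonempty_toType_iff.2 (by simpa using hκ.pos.ne')
  let _ : OrderBot J := WellFoundedLT.toOrderBot J
  have : NoMaxOrder J := noMaxOrder hκ.aleph0_le
  have : IsFiltered J := isFiltered_of_isCardinalFiltered J κ
  refine ⟨Φ.iteration J, Φ.ιIteration J, W.transfiniteCompositionsOfShape_le J _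
    ((Φ.transfiniteCompositionOfShapeιIteration J).ofLE hΦ).mem, fun f => ?_⟩
  obtain ⟨X', b, hb⟩ := exists_range_toSucc_comp_eq Φ f
    (hM.of_injective _ Subtype.val_injective)
  have hbf : Set.range (b ≫ f) = Set.range f := by
    refine Set.Subset.antisymm ?_ (hb.symm.subset.trans ?_)
    all_goals rw [ConcreteCategory.coe_comp]; exact Set.range_comp_subset_range _ _
  rw [← hbf]
  exact hQ X' (b ≫ f) (hb.trans hbf.symm)

end TransfiniteIteration

/-! ### Modules over rings of global dimension at most one -/

section ModuleCat

variable {R : Type v₁} [Ring R]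

instance : PreservesFilteredColimitsOfSize.{u, u} (forget (ModuleCat.{u} R)) where
  preserves_filtered_colimits J _ _ :=
    have := ModuleCat.forget₂PreservesColimitsOfShape R J
    comp_preservesColimitsOfShape (forget₂ (ModuleCat.{u} R) AddCommGrpCat.{u})
      (forget AddCommGrpCat.{u})

variable [Small.{u} R]

instance : IsGrothendieckAbelian.{u} (ModuleCat.{u} R) where
  ab5OfSize := ⟨fun J _ _ =>
    HasExactColimitsOfShape.domain_of_functor J (forget₂ (ModuleCat.{u} R) AddCommGrpCat.{u})⟩

variable [∀ X : ModuleCat.{u} R, HasProjectiveDimensionLT X 2] {N B : ModuleCat.{u} R}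

lemma exists_extOrthogonalMonos_forall_range_eq_imp_fg
    (hN : ∀ A : ModuleCat.{u} R, Subsingleton (Ext.{u} A N 1) → ¬ Module.Finite R A →
      ∃ H : ModuleCat.{u} R, Subsingleton (Ext.{u} H N 1) ∧ Nontrivial (Ext.{u} H A 1))
    (hB : Subsingleton (Ext.{u} B N 1)) (X : ModuleCat.{u} R) :
    ∃ (Y : ModuleCat.{u} R) (i : X ⟶ Y), extOrthogonalMonos.{u} N i ∧
      ∀ f : Y ⟶ B, Set.range (i ≫ f) = Set.range f → f.hom.range.FG := by
  let ι := {h : X ⟶ B // ¬ h.hom.range.FG}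
  let r (h : ι) : X ⟶ ModuleCat.of R h.1.hom.range := ModuleCat.ofHom h.1.hom.rangeRestrict
  have (h : ι) : Epi (r h) :=
    (ModuleCat.epi_iff_surjective _).2 h.1.hom.surjective_rangeRestrict
  have hH (h : ι) : ∃ H : ModuleCat.{u} R, HasProjectiveDimensionLT H 2 ∧
      Subsingleton (Ext.{u} H N 1) ∧ Nontrivial (Ext.{u} H (.of R h.1.hom.range) 1) := by
    have hrange := subsingleton_ext_one_of_mono (ModuleCat.ofHom h.1.hom.range.subtype) hB
    obtain ⟨H, hHN, hHA⟩ := hN _ hrange fun hfin => h.2 (Module.Finite.iff_fg.1 hfin)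
    exact ⟨H, inferInstance, hHN, hHA⟩
  obtain ⟨Y, i, hi, hs⟩ := exists_extOrthogonalMonos_forall_forall_comp_ne _ r hH
  refine ⟨Y, i, hi, fun f hf => ?_⟩
  have hrange : (i ≫ f).hom.range = f.hom.range := SetLike.coe_injective hf
  by_contra hfg
  let s : Y ⟶ .of R (i ≫ f).hom.range := ModuleCat.ofHom
    (f.hom.codRestrict _ fun y => hrange ▸ LinearMap.mem_range_self f.hom y)
  exact hs ⟨i ≫ f, hrange ▸ hfg⟩ s rfl

theorem exists_extOrthogonalMonos_forall_range_fg
    (hN : ∀ A : ModuleCat.{u} R, Subsingleton (Ext.{u} A N 1) → ¬ Module.Finite R A →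
      ∃ H : ModuleCat.{u} R, Subsingleton (Ext.{u} H N 1) ∧ Nontrivial (Ext.{u} H A 1))
    (hB : Subsingleton (Ext.{u} B N 1)) (X : ModuleCat.{u} R) :
    ∃ (Y : ModuleCat.{u} R) (i : X ⟶ Y), extOrthogonalMonos.{u} N i ∧
      ∀ f : Y ⟶ B, f.hom.range.FG := by
  have hspan {Y : ModuleCat.{u} R} (f : Y ⟶ B) :
      Submodule.span R (Set.range f) = f.hom.range := Submodule.span_eq f.hom.range
  obtain ⟨Y, i, hi, hfg⟩ := exists_mem_forall_range_of_forall_range_comp_eq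
    (W := extOrthogonalMonos.{u} N) (Q := fun s : Set B => (Submodule.span R s).FG)
    (by simpa only [hspan] using exists_extOrthogonalMonos_forall_range_eq_imp_fg hN hB) X
  exact ⟨Y, i, hi, fun f => hspan f ▸ hfg f⟩

end ModuleCat

section Int

lemma exists_eq_moduleCat_of_int (X : ModuleCat.{u} ℤ) :
    ∃ (A : Type u) (_ : AddCommGroup A), X = ModuleCat.of ℤ A := by
  obtain @⟨A, inst, mod⟩ := X
  obtain rfl : mod = AddCommGroup.toIntModule A := Subsingleton.elim _ _
  exact ⟨A, inst, rfl⟩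

lemma injective_moduleCat_of_divisibleBy (D : Type u) [AddCommGroup D] [DivisibleBy D ℤ] :
    Injective (ModuleCat.of ℤ D) :=
  Module.injective_object_of_injective_module (inj := (Module.Baer.of_divisible D).injective)

instance (X : ModuleCat.{u} ℤ) : HasInjectiveDimensionLT X 2 := by
  obtain ⟨A, _, rfl⟩ := exists_eq_moduleCat_of_int X
  let ev : A →ₗ[ℤ] (CharacterModule A → AddCircle (1 : ℚ)) :=
    LinearMap.pi fun c => c.toIntLinearMap
  have hev : Function.Injective ev := (injective_iff_map_eq_zero ev).2 fun a ha =>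
    CharacterModule.eq_zero_of_character_apply (congrFun ha)
  have : DivisibleBy (_ ⧸ ev.range) ℤ :=
    ev.range.mkQ_surjective.divisibleBy _ fun a n => map_zsmul _ n a
  let S : ShortComplex (ModuleCat.{u} ℤ) :=
    .mk (ModuleCat.ofHom ev) (ModuleCat.ofHom ev.range.mkQ)
      (ModuleCat.hom_ext ev.range_mkQ_comp)
  have hS : S.ShortExact := ModuleCat.shortComplex_shortExact S
    (LinearMap.exact_map_mkQ_range ev) hev ev.range.mkQ_surjective
  have : Injective S.X₂ := injective_moduleCat_of_divisibleBy _
  have : Injective S.X₃ := injective_moduleCat_of_divisibleBy (_ ⧸ ev.range)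
  exact hS.hasInjectiveDimensionLT_X₁ 1 inferInstance inferInstance

instance (X : ModuleCat.{u} ℤ) : HasProjectiveDimensionLT X 2 :=
  hasProjectiveDimensionLT_of_enoughInjectives _ _ fun Y =>
    HasInjectiveDimensionLT.subsingleton Y 2 2 le_rfl X

end Int

/-! ### Whitehead groups of finite rank -/

section Characters

/-- Every character of `A` lifts to a homomorphism to the reals: by the divisibility of `ℝ`, this is
what `Ext(A, ℤ) = 0` means in terms of `0 → ℤ → ℝ → ℝ / ℤ → 0`. -/
def CharactersLift (A : Type*) [AddCommGroup A] : Prop :=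
  ∀ χ : A →+ UnitAddCircle, ∃ g : A →+ ℝ, ∀ a, (g a : UnitAddCircle) = χ a

lemma coe_unitAddCircle_eq_zero_iff {x : ℝ} :
    (x : UnitAddCircle) = 0 ↔ ∃ n : ℤ, (n : ℝ) = x := by
  simp [AddSubgroup.mem_zmultiples_iff]

lemma exists_injective_ratAddCircle_unitAddCircle :
    ∃ φ : AddCircle (1 : ℚ) →+ UnitAddCircle, Function.Injective φ := by
  let φ : AddCircle (1 : ℚ) →+ UnitAddCircle :=
    QuotientAddGroup.map (AddSubgroup.zmultiples (1 : ℚ)) (AddSubgroup.zmultiples (1 : ℝ))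
      (Rat.castHom ℝ).toAddMonoidHom
      (AddSubgroup.zmultiples_le.2 (AddSubgroup.mem_comap.2 (by simp)))
  refine ⟨φ, (injective_iff_map_eq_zero φ).2 fun q hq => ?_⟩
  obtain ⟨q, rfl⟩ := QuotientAddGroup.mk_surjective q
  obtain ⟨n, hn⟩ := coe_unitAddCircle_eq_zero_iff.1 (show ((q : ℝ) : UnitAddCircle) = 0 from hq)
  exact (AddCircle.coe_eq_zero_iff 1).2 ⟨n, by rw [zsmul_one]; exact_mod_cast hn⟩

lemma exists_unitAddCircle_character_ne_zero {A : Type*} [AddCommGroup A] {a : A} (ha : a ≠ 0) :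
    ∃ χ : A →+ UnitAddCircle, χ a ≠ 0 := by
  obtain ⟨c, hc⟩ := CharacterModule.exists_character_apply_ne_zero_of_ne_zero ha
  obtain ⟨φ, hφ⟩ := exists_injective_ratAddCircle_unitAddCircle
  exact ⟨φ.comp c, (map_ne_zero_iff φ hφ).2 hc⟩

lemma discreteTopology_of_countable_of_baireSpace (G : Type*) [AddGroup G] [TopologicalSpace G]
    [SeparatelyContinuousAdd G] [T1Space G] [BaireSpace G] [Countable G] : DiscreteTopology G := by
  obtain ⟨g, hg⟩ := nonempty_interior_of_iUnion_of_closed (f := fun g : G => ({g} : Set G))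
    (fun _ => isClosed_singleton) (Set.iUnion_of_singleton G)
  have hopen : IsOpen ({g} : Set G) :=
    (hg.subset_singleton_iff.1 interior_subset) ▸ isOpen_interior
  refine discreteTopology_of_isOpen_singleton_zero ?_
  simpa using hopen.preimage (continuous_const_add g)

/-- The Pontryagin dual of the discrete group `A` is compact, so it is finite if countable, and
then its order annihilates `A`. -/
lemma exponentExists_of_countable_characters {A : Type*} [AddCommGroup A]
    [Countable (A →+ UnitAddCircle)] : AddMonoid.ExponentExists A := by
  let dual : AddSubgroup (A → UnitAddCircle) := (AddMonoidHom.coeFn A UnitAddCircle).range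
  have : CompactSpace dual := isCompact_iff_compactSpace.1
    (AddMonoidHom.isClosed_range_coe A UnitAddCircle).isCompact
  have : Countable dual := Set.countable_range _
  have := discreteTopology_of_countable_of_baireSpace dual
  have : Finite dual := finite_of_compact_of_discrete
  refine ⟨Nat.card dual, Nat.card_pos, fun a => ?_⟩
  by_contra ha
  obtain ⟨χ, hχ⟩ := exists_unitAddCircle_character_ne_zero ha
  have hdual : Nat.card dual • (⟨χ, χ, rfl⟩ : dual) = 0 := card_nsmul_eq_zero'
  exact hχ ((map_nsmul χ _ a).trans (congrFun (congrArg Subtype.val hdual) a))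

lemma exists_fg_isTorsion_quotient_of_rank_lt_aleph0 {R M : Type*} [CommRing R] [IsDomain R]
    [AddCommGroup M] [Module R M] (hM : Module.rank R M < ℵ₀) :
    ∃ F : Submodule R M, F.FG ∧ Module.IsTorsion R (M ⧸ F) := by
  obtain ⟨s, hs, hmax⟩ := exists_maximal_linearIndepOn R (id : M → M)
  have hfin : s.Finite :=
    lt_aleph0_iff_set_finite.1 ((LinearIndependent.cardinal_le_rank hs).trans_lt hM)
  refine ⟨Submodule.span R s, Submodule.fg_span hfin, fun x => ?_⟩
  obtain ⟨x, rfl⟩ := (Submodule.span R s).mkQ_surjective x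
  obtain ⟨a, ha, hax⟩ : ∃ a : R, a ≠ 0 ∧ a • x ∈ Submodule.span R s := by
    by_cases hx : x ∈ s
    · exact ⟨1, one_ne_zero, by simpa using Submodule.subset_span hx⟩
    · simpa using hmax x hx
  exact ⟨⟨a, mem_nonZeroDivisors_of_ne_zero ha⟩, (Submodule.Quotient.mk_eq_zero _).2 hax⟩

lemma eq_of_eqOn_of_isTorsion_quotient {R M N : Type*} [CommRing R] [IsDomain R]
    [AddCommGroup M] [Module R M] [AddCommGroup N] [Module R N] [Module.IsTorsionFree R N]
    {F : Submodule R M} (hF : Module.IsTorsion R (M ⧸ F)) {g g' : M →ₗ[R] N}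
    (h : Set.EqOn g g' F) : g = g' := by
  ext x
  obtain ⟨a, ha⟩ := @hF (F.mkQ x)
  have hax := h ((Submodule.Quotient.mk_eq_zero F).1 ha)
  rw [map_smul, map_smul] at hax
  exact smul_right_injective N (nonZeroDivisors.coe_ne_zero a) hax

namespace CharactersLift

variable {A : Type*} [AddCommGroup A]

lemma isAddTorsionFree (hA : CharactersLift A) : IsAddTorsionFree A := by
  refine ⟨fun n hn => (injective_iff_map_eq_zero (nsmulAddMonoidHom (α := A) n)).2 fun a ha => ?_⟩
  by_contra ha₀
  obtain ⟨χ, hχ⟩ := exists_unitAddCircle_character_ne_zero ha₀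
  obtain ⟨g, hg⟩ := hA χ
  have hga : g a = 0 := (smul_eq_zero.1 ((map_nsmul g n a).symm.trans
    ((congrArg g ha).trans (map_zero g)))).resolve_left hn
  exact hχ (by rw [← hg, hga, QuotientAddGroup.mk_zero])

/-- A real lift of a character that vanishes on `F` is determined by its values on generators of
`F`, and these are integers. -/
lemma countable_characters_quotient (hA : CharactersLift A) {F : Submodule ℤ A} (hF : F.FG)
    (htors : Module.IsTorsion ℤ (A ⧸ F)) : Countable ((A ⧸ F) →+ UnitAddCircle) := by
  obtain ⟨s, rfl⟩ := hF
  have hlift (χ : (A ⧸ Submodule.span ℤ (s : Set A)) →+ UnitAddCircle) :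
      ∃ (g : A →+ ℝ) (n : s → ℤ), (∀ a, (g a : UnitAddCircle) = χ (Submodule.mkQ _ a)) ∧
        ∀ x : s, (n x : ℝ) = g x := by
    obtain ⟨g, hg⟩ := hA (χ.comp (Submodule.mkQ _).toAddMonoidHom)
    have hint (x : s) : ∃ n : ℤ, (n : ℝ) = g x := coe_unitAddCircle_eq_zero_iff.1 <| by
      have hx := (Submodule.Quotient.mk_eq_zero _).2 (Submodule.subset_span (R := ℤ) x.2)
      exact (hg x).trans ((congrArg χ hx).trans (map_zero χ))
    choose n hn using hint
    exact ⟨g, n, hg, hn⟩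
  choose g n hg hn using hlift
  refine Function.Injective.countable (f := n) fun χ ψ h => ?_
  have hgen : Set.EqOn (g χ).toIntLinearMap (g ψ).toIntLinearMap s := fun x hx =>
    (hn χ ⟨x, hx⟩).symm.trans ((congrArg (fun m => (m ⟨x, hx⟩ : ℝ)) h).trans (hn ψ ⟨x, hx⟩))
  have heq := eq_of_eqOn_of_isTorsion_quotient htors (LinearMap.eqOn_span' hgen)
  ext a
  obtain ⟨a, rfl⟩ := Submodule.mkQ_surjective _ a
  rw [← hg, ← hg]
  exact congrArg (fun l => ((l a : ℝ) : UnitAddCircle)) heq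

theorem finite_of_rank_lt_aleph0 (hA : CharactersLift A) (hrank : Module.rank ℤ A < ℵ₀) :
    Module.Finite ℤ A := by
  obtain ⟨F, hF, htors⟩ := exists_fg_isTorsion_quotient_of_rank_lt_aleph0 hrank
  have := hA.countable_characters_quotient hF htors
  obtain ⟨n, hn, hnA⟩ := exponentExists_of_countable_characters (A := A ⧸ F)
  have hmem (a : A) : n • a ∈ F := (Submodule.Quotient.mk_eq_zero F).1 (hnA (F.mkQ a))
  have : Module.Finite ℤ F := Module.Finite.iff_fg.2 hF
  have := hA.isAddTorsionFree
  let mulN : A →ₗ[ℤ] F := (nsmulAddMonoidHom (α := A) n).toIntLinearMap.codRestrict F hmem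
  exact Module.Finite.of_injective mulN fun a b hab =>
    nsmul_right_injective hn.ne' (congrArg Subtype.val hab)

end CharactersLift

end Characters

section Whitehead

namespace IsWhitehead

lemma charactersLift {A : Type u} [AddCommGroup A] (hA : IsWhitehead A) : CharactersLift A := by
  let incl : ℤ →ₗ[ℤ] ℝ := (Int.castAddHom ℝ).toIntLinearMap
  let proj : ℝ →ₗ[ℤ] UnitAddCircle :=
    (QuotientAddGroup.mk' (AddSubgroup.zmultiples (1 : ℝ))).toIntLinearMap
  have hS := ModuleCat.shortComplexOfConj_shortExact (ULift.moduleEquiv.{0, 0, u} (R := ℤ))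
    (ULift.moduleEquiv.{0, 0, u} (R := ℤ)) (ULift.moduleEquiv.{0, 0, u} (R := ℤ)) incl proj
    (fun _ => coe_unitAddCircle_eq_zero_iff) Int.cast_injective
    (QuotientAddGroup.mk'_surjective _)
  have := injective_moduleCat_of_divisibleBy (ULift.{u} ℝ)
  intro χ
  obtain ⟨g, hg⟩ := (subsingleton_ext_one_iff_forall_exists_lift hS (.of ℤ A)).1 hA
    (ModuleCat.ofHom (ULift.moduleEquiv.symm.toLinearMap ∘ₗ χ.toIntLinearMap))
  exact ⟨AddEquiv.ulift.toAddMonoidHom.comp g.hom.toAddMonoidHom,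
    fun a => congrArg ULift.down (ConcreteCategory.congr_hom hg a)⟩

lemma finsupp_int (ι : Type u) : IsWhitehead (ι →₀ ℤ) := by
  have := ModuleCat.projective_of_free (M := .of ℤ (ι →₀ ℤ)) Finsupp.basisSingleOne
  exact subsingleton_of_forall_eq 0 fun x => Ext.eq_zero_of_projective x

end IsWhitehead

theorem mainTheorem5_general
    (hExt : ∀ (A : Type u) [AddCommGroup A], IsWhitehead A → ℵ₀ ≤ Module.rank ℤ A →
      ∃ (H : Type u) (_ : AddCommGroup H), IsWhitehead H ∧ Nontrivial (ExtGroup H A))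
    (B : Type u) [AddCommGroup B] (hB : IsWhitehead B) (κ : Cardinal.{u}) :
    ∃ (G : Type u) (_ : AddCommGroup G),
      IsWhitehead G ∧ κ ≤ #G ∧ ∀ f : G →+ B, f.range.FG := by
  have hN (X : ModuleCat.{u} ℤ) (hX : Subsingleton (Ext.{u} X (.of ℤ (ULift.{u} ℤ)) 1))
      (hfin : ¬ Module.Finite ℤ X) : ∃ H : ModuleCat.{u} ℤ,
        Subsingleton (Ext.{u} H (.of ℤ (ULift.{u} ℤ)) 1) ∧ Nontrivial (Ext.{u} H X 1) := by
    obtain ⟨A, _, rfl⟩ := exists_eq_moduleCat_of_int X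
    have hrank := le_of_not_gt (mt (IsWhitehead.charactersLift hX).finite_of_rank_lt_aleph0 hfin)
    obtain ⟨H, _, hH, hHA⟩ := hExt A hX hrank
    exact ⟨.of ℤ H, hH, hHA⟩
  obtain ⟨Y, i, hi, hfg⟩ :=
    exists_extOrthogonalMonos_forall_range_fg hN hB (.of ℤ (κ.out →₀ ℤ))
  obtain ⟨G, _, rfl⟩ := exists_eq_moduleCat_of_int Y
  refine ⟨G, _, hi.subsingleton_ext (IsWhitehead.finsupp_int κ.out), ?_, fun f => ?_⟩
  · have hinj := ((ModuleCat.mono_iff_injective i).1 hi.1).comp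
      (Finsupp.single_left_injective (α := κ.out) (one_ne_zero (α := ℤ)))
    simpa using mk_le_of_injective hinj
  · have := hfg (ModuleCat.ofHom f.toIntLinearMap)
    exact Submodule.fg_iff_addSubgroup_fg _ |>.1 this

end Whitehead

theorem mainTheorem5
    (gch : GCH.{u})
    (hExt : ∀ (A : Type u) [AddCommGroup A], IsWhitehead A → ℵ₀ ≤ Module.rank ℤ A →
      ∃ (H : Type u) (_ : AddCommGroup H),
        IsWhitehead H ∧ #H ≤ Order.succ #A ∧ Nontrivial (ExtGroup H A))
    (B : Type u) [AddCommGroup B] (hB : IsWhitehead B) :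
    ∃ (G : Type u) (_ : AddCommGroup G),
      IsWhitehead G ∧ Uncountable G ∧ ∀ f : G →+ B, f.range.FG := by
  obtain ⟨G, _, hG, hcard, hfg⟩ := mainTheorem5_general (fun A _ hA hrank => by
    obtain ⟨H, _, hH, -, hHA⟩ := hExt A hA hrank
    exact ⟨H, _, hH, hHA⟩) B hB ℵ₁
  exact ⟨G, _, hG, aleph0_lt_mk_iff.1 (aleph0_lt_aleph_one.trans_le hcard), hfg⟩
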